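/- Let $N\ge 0$ and $M\ge 1$ be integers, let $0<q\le 1$, and let $y_1,\dots,y_M\in[0,1)$ be $q$-separated, i.e. $\min_{k\in\mathbb Z}|y_i-y_j-k|\ge q$ for all $i\ne j$. Let $$V_N(y_1,\dots,y_M)=\left(e^{2\pi i k y_j}\right)_{k=0,\dots,N-1;\ j=1,\dots,M}\in\mathbb C^{N\times M}$$ be the Vandermonde matrix with these frequencies. Then its smallest singular value $\sigma_{\min}$ (the square root of the smallest eigenvalue of the $M\times M$ matrix $V_N^*V_N$) satisfies $$\sigma_{\min}^2\ \ge\ N+1-\frac1q .$$ -/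

import Mathlib

/-- The wrap-around distance `min_{k ∈ ℤ} |y - y' - k|` of two frequencies. -/
noncomputable def wrapDist (y y' : ℝ) : ℝ := ⨅ k : ℤ, |y - y' - k|

/-- The infimum in `wrapDist` is a minimum. -/
theorem wrapDist_isLeast (y y' : ℝ) :
    IsLeast (Set.range fun k : ℤ => |y - y' - k|) (wrapDist y y') := by
  have h : IsLeast (Set.range fun k : ℤ => |y - y' - k|) |y - y' - round (y - y')| := by
    refine ⟨⟨round (y - y'), rfl⟩, ?_⟩
    rintro _ ⟨k, rfl⟩
    exact round_le (y - y') k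
  have e : wrapDist y y' = |y - y' - round (y - y')| := h.csInf_eq
  rw [e]
  exact h

/-- The frequencies `y_1, …, y_M` are `q`-separated: any two of them with different indices have
wrap-around distance at least `q`. For `q > 0` they are in particular pairwise distinct. -/
def QSeparated {M : ℕ} (q : ℝ) (y : Fin M → ℝ) : Prop :=
  ∀ i j : Fin M, i ≠ j → q ≤ wrapDist (y i) (y j)

/-- The `N × M` Vandermonde matrix with entries `exp (2 π i k y_j)`, where `k = 0, …, N - 1`. -/
noncomputable def expVandermonde {M : ℕ} (N : ℕ) (y : Fin M → ℝ) : Matrix (Fin N) (Fin M) ℂ :=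
  Matrix.of fun k j => Complex.exp (2 * Real.pi * Complex.I * ((k : ℕ) : ℂ) * (y j : ℂ))

/-- The smallest singular value of a complex `N × M` matrix (with `M ≥ 1`): the last one of its
singular values `σ_1 ≥ ⋯ ≥ σ_M`, which are the square roots of the `M` eigenvalues of `Aᴴ A`
with respect to the Euclidean inner products. Mathlib's sequence of singular values is decreasing
and indexed from `0`. -/
noncomputable def smallestSingularValue {N M : ℕ} (A : Matrix (Fin N) (Fin M) ℂ) : ℝ :=
  (Matrix.toEuclideanLin A).singularValues (M - 1)

/-!
The proof is elementary and avoids extremal functions of Beurling–Selberg type. It rests on the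
Hilbert inequality of Montgomery and Vaughan: for `δ`-separated points `x_r` of `ℝ / ℤ`,
`|∑_{r ≠ t} csc (π (x_r - x_t)) conj (u_r) u_t| ≤ δ⁻¹ ∑ |u_r|²`
(`im_csc_form_le`, `neg_le_im_csc_form`).

The form is `-i` times a Hermitian form, so it suffices to bound its eigenvalues. For an eigenvector
`u` one expands `∑_s |∑_r c_{sr} u_r|²`, where `c` is the cosecant kernel, by the identity
`csc a csc b = csc (a - b) (cot b - cot a)`. The sums of cotangents cancel because of the eigenvalue
equation, and what is left is governed by the row sums of `csc² + 2 |csc cot|`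
(`sq_eigenvalue_mul_le_of_cot_identity`). This function is at most `3 / (π ‖d‖)²`, with `‖d‖` the
distance of `d` to the nearest integer, and the sum of `3 / (π ‖x_r - x_t‖)²` over `t` is at most
`δ⁻²`, since on either side of `x_r` the points have distances at least `δ, 2δ, 3δ, …` and
`∑ 1 / n² = π² / 6`.

Summing the geometric series in `∑_{k < n} |∑_j a_j e(k x_j)|²`, where `e(t) = exp (2 π i t)`,
gives `n ∑ |a_j|²` plus half the difference of two forms of the above type, hence the lower bound
`n - 1 / δ` (`sub_inv_mul_sum_le_sum_norm_exp_sum`). To improve `N - 1 / q` to `N + 1 - 1 / q`, one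
applies this bound to the `q / K`-separated points `(y_j + l) / K`, `0 ≤ l < K`, with
`n = N K + K - 1` consecutive frequencies. Summation over `l` annihilates all frequencies but the
multiples of `K`, of which there are only `N`; the resulting constant is `N + 1 - 1 / K - 1 / q`, and
`K → ∞`.
-/

open ComplexConjugate

/-! ### Pointwise bound for `csc² + 2 |csc cot|` -/

/-- Near `0` both sides agree up to terms of order `x ^ 6`. With `t = x / 2` the inequality becomes
polynomial in `t ^ 2` and `sin t ^ 2`. -/
theorem sq_mul_one_add_two_mul_cos_le {x : ℝ} (h0 : 0 ≤ x) (h1 : x ≤ Real.pi / 2) :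
    x ^ 2 * (1 + 2 * Real.cos x) ≤ 3 * Real.sin x ^ 2 := by
  obtain ⟨t, rfl⟩ : ∃ t, x = 2 * t := ⟨x / 2, by ring⟩
  have ht0 : 0 ≤ t := by linarith
  have ht1 : t ≤ 0.8 := by linarith [Real.pi_lt_d2]
  have hsin := Real.sin_ge_sub_cube ht0
  have hle := Real.sin_le ht0
  have hpos : 0 ≤ t - t ^ 3 / 6 := by nlinarith [mul_nonneg ht0 ht0]
  have hS : (t - t ^ 3 / 6) ^ 2 ≤ Real.sin t ^ 2 := by gcongr
  have hT1 : t ^ 2 ≤ 0.64 := by nlinarith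
  have hS' : Real.sin t ^ 2 ≤ t ^ 2 := by
    have : 0 ≤ Real.sin t := hpos.trans hsin
    gcongr
  rw [Real.cos_two_mul', Real.sin_two_mul]
  have hc : Real.cos t ^ 2 = 1 - Real.sin t ^ 2 := by
    linarith [Real.sin_sq_add_cos_sq t]
  have hT0 : 0 ≤ t ^ 2 := sq_nonneg t
  have e1 : (2 * Real.sin t * Real.cos t) ^ 2 = 4 * Real.sin t ^ 2 * (1 - Real.sin t ^ 2) := by
    rw [mul_pow, hc]; ring
  rw [e1, hc]
  have e0 : (t - t ^ 3 / 6) ^ 2 = t ^ 2 - (t ^ 2) ^ 2 / 3 + (t ^ 2) ^ 3 / 36 := by ring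
  rw [e0] at hS
  have e2 : (2 * t) ^ 2 = 4 * t ^ 2 := by ring
  rw [e2]
  generalize Real.sin t ^ 2 = S at *
  generalize t ^ 2 = T at *
  -- Here `S = sin² t` and `T = t²`. The difference of the two sides is increasing in `S` on this
  -- range, so `S` may be replaced by its lower bound `(t - t³ / 6)²`.
  have key : 0 ≤ (S - (T - T ^ 2 / 3 + T ^ 3 / 36)) *
      (3 + 4 * T - 3 * (S + (T - T ^ 2 / 3 + T ^ 3 / 36))) := by
    apply mul_nonneg <;> nlinarith
  have low : 0 ≤ T ^ 3 * (3 / 4 - 7 / 18 * T + T ^ 2 / 18 - T ^ 3 / 432) := by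
    have h2 : T ^ 2 ≤ 0.5 := by nlinarith
    have h3 : T ^ 3 ≤ 0.5 := by nlinarith
    have : 0 ≤ T ^ 2 := by positivity
    apply mul_nonneg (by positivity)
    linarith
  linarith [key, low]

/-- At integers `d` both sides are `0`, because `0⁻¹ = 0`. -/
theorem csc_sq_add_two_mul_abs_csc_mul_cot_le (d : ℝ) :
    (Real.sin (Real.pi * d))⁻¹ ^ 2 +
        2 * |(Real.sin (Real.pi * d))⁻¹ * (Real.cos (Real.pi * d) / Real.sin (Real.pi * d))| ≤
      3 / Real.pi ^ 2 * (|d - round d| ^ 2)⁻¹ := by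
  set e := |d - round d| with he
  have he0 : 0 ≤ e := abs_nonneg _
  have he1 : e ≤ 1 / 2 := abs_sub_round d
  have hsc : Real.sin (Real.pi * d) ^ 2 = Real.sin (Real.pi * e) ^ 2 ∧
      |Real.cos (Real.pi * d)| = Real.cos (Real.pi * e) := by
    have hd : Real.pi * d = Real.pi * (d - round d) + round d * Real.pi := by ring
    have h1 : Real.cos (Real.pi * e) = Real.cos (Real.pi * (d - round d)) := by
      rw [he, ← Real.cos_abs (Real.pi * (d - round d)), abs_mul, abs_of_pos Real.pi_pos]
    have h2 : |Real.cos (Real.pi * d)| = |Real.cos (Real.pi * e)| := by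
      rw [hd, Real.cos_add_int_mul_pi, h1, abs_mul]
      simp
    have h3 : 0 ≤ Real.cos (Real.pi * e) := by
      apply Real.cos_nonneg_of_neg_pi_div_two_le_of_le <;> nlinarith [Real.pi_pos]
    have h4 : Real.cos (Real.pi * d) ^ 2 = Real.cos (Real.pi * e) ^ 2 := by
      rw [← sq_abs, h2, sq_abs]
    refine ⟨?_, h2.trans (abs_of_nonneg h3)⟩
    rw [Real.sin_sq, Real.sin_sq, h4]
  have hl : (Real.sin (Real.pi * d))⁻¹ ^ 2 +
        2 * |(Real.sin (Real.pi * d))⁻¹ * (Real.cos (Real.pi * d) / Real.sin (Real.pi * d))| =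
      (1 + 2 * Real.cos (Real.pi * e)) / Real.sin (Real.pi * e) ^ 2 := by
    rw [← hsc.1, ← hsc.2, abs_mul, abs_div, abs_inv]
    have : (Real.sin (Real.pi * d)) ^ 2 = |Real.sin (Real.pi * d)| ^ 2 := (sq_abs _).symm
    rw [inv_pow, this]
    ring
  rw [hl]
  rcases he0.eq_or_lt with h | h
  · simp [← h]
  have hpe : 0 < Real.pi * e := by positivity
  have hpe' : Real.pi * e ≤ Real.pi / 2 := by nlinarith [Real.pi_pos]
  have hs : 0 < Real.sin (Real.pi * e) :=
    Real.sin_pos_of_pos_of_lt_pi hpe (by linarith [Real.pi_pos])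
  have := sq_mul_one_add_two_mul_cos_le hpe.le hpe'
  have e3 : 3 / Real.pi ^ 2 * (e ^ 2)⁻¹ = 3 / (Real.pi * e) ^ 2 := by
    field_simp
  rw [e3, div_le_div_iff₀ (by positivity) (by positivity)]
  linarith

/-! ### Sums over separated points -/

/-- The numbers `⌊f i / δ⌋` are distinct positive integers, so the sum is dominated by `ζ(2)`. -/
theorem sum_inv_sq_le_of_separated {ι : Type*} (s : Finset ι) (f : ι → ℝ) {δ : ℝ} (hδ : 0 < δ)
    (hf : ∀ i ∈ s, δ ≤ f i) (hsep : ∀ i ∈ s, ∀ j ∈ s, i ≠ j → δ ≤ |f i - f j|) :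
    ∑ i ∈ s, (f i ^ 2)⁻¹ ≤ Real.pi ^ 2 / 6 * (δ ^ 2)⁻¹ := by
  have hinj : Set.InjOn (fun i => ⌊f i / δ⌋₊) s := by
    intro i hi j hj hij
    by_contra hne
    have h := hsep i hi j hj hne
    simp only at hij
    have pi : 0 ≤ f i / δ := div_nonneg (hδ.le.trans (hf i hi)) hδ.le
    have pj : 0 ≤ f j / δ := div_nonneg (hδ.le.trans (hf j hj)) hδ.le
    have a1 := Nat.floor_le pi
    have a2 := Nat.lt_floor_add_one (f i / δ)
    have b1 := Nat.floor_le pj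
    have b2 := Nat.lt_floor_add_one (f j / δ)
    rw [hij] at a1 a2
    have : |f i / δ - f j / δ| < 1 := by rw [abs_lt]; constructor <;> linarith
    rw [← sub_div, abs_div, abs_of_pos hδ, div_lt_one hδ] at this
    linarith
  calc ∑ i ∈ s, (f i ^ 2)⁻¹ ≤ ∑ i ∈ s, (1 / (⌊f i / δ⌋₊ : ℝ) ^ 2) * (δ ^ 2)⁻¹ := by
        refine Finset.sum_le_sum fun i hi => ?_
        have h1 : 1 ≤ f i / δ := (one_le_div hδ).2 (hf i hi)
        have h2 : 1 ≤ ⌊f i / δ⌋₊ := Nat.one_le_floor_iff _ |>.2 h1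
        have h3 := Nat.floor_le (zero_le_one.trans h1)
        rw [one_div, ← mul_inv, ← mul_pow]
        have h4 : (0 : ℝ) < ⌊f i / δ⌋₊ := by exact_mod_cast h2
        have h5 : (⌊f i / δ⌋₊ : ℝ) * δ ≤ f i := (le_div_iff₀ hδ).1 h3
        gcongr
    _ = (∑ n ∈ s.image fun i => ⌊f i / δ⌋₊, 1 / (n : ℝ) ^ 2) * (δ ^ 2)⁻¹ := by
        rw [Finset.sum_image hinj, Finset.sum_mul]
    _ ≤ Real.pi ^ 2 / 6 * (δ ^ 2)⁻¹ := by
        gcongr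
        exact sum_le_hasSum _ (fun n _ => by positivity) hasSum_zeta_two

/-- The term `t = r` contributes `0⁻¹ = 0`; the others are split according to the side of `x r` on
which `x t` lies. -/
theorem sum_inv_sq_abs_sub_round_le {ι : Type*} [Fintype ι] [DecidableEq ι] (x : ι → ℝ) {δ : ℝ}
    (hδ : 0 < δ) (hsep : ∀ i j, i ≠ j → ∀ k : ℤ, δ ≤ |x i - x j - k|) (r : ι) :
    ∑ t, (|x r - x t - round (x r - x t)| ^ 2)⁻¹ ≤ Real.pi ^ 2 / 3 * (δ ^ 2)⁻¹ := by
  set e : ι → ℝ := fun t => x r - x t - round (x r - x t) with he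
  have he1 : ∀ t, t ≠ r → δ ≤ |e t| := fun t ht => hsep r t ht.symm _
  have he2 : ∀ i j, i ≠ j → δ ≤ |e i - e j| := by
    intro i j hij
    have := hsep j i hij.symm (round (x r - x i) - round (x r - x j))
    convert this using 2
    push_cast
    simp only [he]
    ring
  have her : e r = 0 := by simp [he]
  have hpos := sum_inv_sq_le_of_separated (Finset.univ.filter fun t => 0 < e t) e hδ
    (fun t ht => by
      have ht := (Finset.mem_filter.1 ht).2
      have := he1 t (by rintro rfl; exact ht.ne' her)
      rwa [abs_of_pos ht] at this)
    (fun i _ j _ hij => he2 i j hij)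
  have hneg := sum_inv_sq_le_of_separated (Finset.univ.filter fun t => ¬ 0 < e t ∧ t ≠ r)
    (fun t => - e t) hδ
    (fun t ht => by
      obtain ⟨h1, h2⟩ := (Finset.mem_filter.1 ht).2
      have := he1 t h2
      rwa [abs_of_nonpos (not_lt.1 h1)] at this)
    (fun i _ j _ hij => by
      have := he2 j i hij.symm
      convert this using 2
      ring)
  have hrest : ∑ t ∈ Finset.univ.filter (fun t => ¬ 0 < e t), (e t ^ 2)⁻¹ =
      ∑ t ∈ Finset.univ.filter (fun t => ¬ 0 < e t ∧ t ≠ r), ((- e t) ^ 2)⁻¹ := by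
    rw [Finset.sum_filter, Finset.sum_filter]
    refine Finset.sum_congr rfl fun t _ => ?_
    by_cases h : t = r
    · subst h; simp [her]
    · simp [h]
  calc ∑ t, (|e t| ^ 2)⁻¹ = ∑ t, (e t ^ 2)⁻¹ := by simp
    _ = _ := (Finset.sum_filter_add_sum_filter_not Finset.univ (fun t => 0 < e t) _).symm
    _ ≤ _ := by rw [hrest]; linarith

/-! ### The Hilbert inequality of Montgomery and Vaughan -/

/-- The eigenvalue bound for the antisymmetric kernel `c = csc`, `k = cot`, in the form that only uses
the identity `csc a * csc b = csc (a - b) * (cot b - cot a)` and a bound for the row sums of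
`c ^ 2 + 2 * |c * k|`. -/
theorem sq_eigenvalue_mul_le_of_cot_identity {ι : Type*} [Fintype ι] [DecidableEq ι]
    (c k : ι → ι → ℝ) (hc : ∀ r t, c t r = -c r t) (hk : ∀ r t, k t r = -k r t)
    (hck : ∀ r s t, r ≠ s → s ≠ t → r ≠ t → c s r * c s t = c r t * (k t s - k r s))
    {B : ℝ} (hB : ∀ r, ∑ t, (c r t ^ 2 + 2 * |c r t * k r t|) ≤ B)
    (u : ι → ℂ) (ν : ℝ) (hu : ∀ r, ∑ t, (c r t : ℂ) * u t = Complex.I * ν * u r) :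
    ν ^ 2 * ∑ r, ‖u r‖ ^ 2 ≤ B * ∑ r, ‖u r‖ ^ 2 := by
  have hc0 : ∀ r, c r r = 0 := fun r => by linarith [hc r r]
  have hk0 : ∀ r, k r r = 0 := fun r => by linarith [hk r r]
  -- The off-diagonal entries of `cᵀ c` reduce to row sums of `k`; the summand `2 * (c r t * k r t)`
  -- makes up for the indices `s = r` and `s = t`, where the identity `hck` is not available.
  have hgram : ∀ r t, ∑ s, c s r * c s t = c r t * (∑ s, k t s) - c r t * (∑ s, k r s) +
      2 * (c r t * k r t) + if r = t then ∑ s, c r s ^ 2 else 0 := by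
    intro r t
    by_cases h : r = t
    · subst h
      simp only [hc0, if_true, zero_mul, sub_self, mul_zero, zero_add]
      exact Finset.sum_congr rfl fun s _ => by rw [hc r s]; ring
    · have hs : ∀ s, c s r * c s t = c r t * (k t s - k r s) +
          (if s = r then c r t * k r t else 0) + (if s = t then c r t * k r t else 0) := by
        intro s
        by_cases h1 : s = r
        · subst h1; simp [h, hc0, hk0, hk s t]
        by_cases h2 : s = t
        · subst h2; simp [h1, hc0, hk0]
        simp [h1, h2, hck r s t (Ne.symm h1) h2 h]
      simp only [hs, Finset.sum_add_distrib, Finset.sum_ite_eq', Finset.mem_univ, if_true, h,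
        if_false, ← Finset.mul_sum, Finset.sum_sub_distrib]
      ring
  have hcol : ∀ t, ∑ r, (c r t : ℂ) * u r = -(Complex.I * ν * u t) := by
    intro t
    rw [← hu t, ← Finset.sum_neg_distrib]
    exact Finset.sum_congr rfl fun r _ => by rw [hc t r]; push_cast; ring
  have hrow : ∀ r, ∑ t, (c r t : ℂ) * conj (u t) = -(Complex.I * ν * conj (u r)) := by
    intro r
    have := congrArg conj (hu r)
    simpa using this
  -- After expanding `∑ s, ‖∑ r, c s r * u r‖ ^ 2` by `hgram`, the two terms with row sums of `k` agree
  -- (`e3`, `e4`) because `u` is an eigenvector, and they enter with opposite signs.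
  have hmain : ((ν ^ 2 * ∑ r, ‖u r‖ ^ 2 : ℝ) : ℂ) =
      ∑ r, ∑ t, ((2 * (c r t * k r t) : ℝ) : ℂ) * (u r * conj (u t)) +
        ∑ r, ((∑ s, c r s ^ 2 : ℝ) : ℂ) * (u r * conj (u r)) := by
    have e1 : ((ν ^ 2 * ∑ r, ‖u r‖ ^ 2 : ℝ) : ℂ) =
        ∑ s, (∑ r, (c s r : ℂ) * u r) * ∑ t, (c s t : ℂ) * conj (u t) := by
      push_cast
      rw [Finset.mul_sum]
      refine Finset.sum_congr rfl fun s _ => ?_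
      rw [hu, hrow, ← Complex.mul_conj']
      linear_combination ((ν : ℂ) ^ 2 * (u s * conj (u s))) * Complex.I_sq
    have e2 : ∑ s, (∑ r, (c s r : ℂ) * u r) * ∑ t, (c s t : ℂ) * conj (u t) =
        ∑ r, ∑ t, ((∑ s, c s r * c s t : ℝ) : ℂ) * (u r * conj (u t)) := by
      simp_rw [Finset.sum_mul_sum]
      rw [Finset.sum_comm]
      refine Finset.sum_congr rfl fun r _ => ?_
      rw [Finset.sum_comm]
      refine Finset.sum_congr rfl fun t _ => ?_
      push_cast
      rw [Finset.sum_mul]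
      exact Finset.sum_congr rfl fun s _ => by ring
    have e3 : ∑ r, ∑ t, ((c r t * (∑ s, k t s) : ℝ) : ℂ) * (u r * conj (u t)) =
        -(Complex.I * ν) * ∑ t, ((∑ s, k t s : ℝ) : ℂ) * (u t * conj (u t)) := by
      rw [Finset.sum_comm, Finset.mul_sum]
      refine Finset.sum_congr rfl fun t _ => ?_
      have : ∑ r, ((c r t * (∑ s, k t s) : ℝ) : ℂ) * (u r * conj (u t)) =
          ((∑ s, k t s : ℝ) : ℂ) * conj (u t) * ∑ r, (c r t : ℂ) * u r := by
        rw [Finset.mul_sum]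
        exact Finset.sum_congr rfl fun r _ => by push_cast; ring
      rw [this, hcol]
      ring
    have e4 : ∑ r, ∑ t, ((c r t * (∑ s, k r s) : ℝ) : ℂ) * (u r * conj (u t)) =
        -(Complex.I * ν) * ∑ t, ((∑ s, k t s : ℝ) : ℂ) * (u t * conj (u t)) := by
      rw [Finset.mul_sum]
      refine Finset.sum_congr rfl fun r _ => ?_
      have : ∑ t, ((c r t * (∑ s, k r s) : ℝ) : ℂ) * (u r * conj (u t)) =
          ((∑ s, k r s : ℝ) : ℂ) * u r * ∑ t, (c r t : ℂ) * conj (u t) := by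
        rw [Finset.mul_sum]
        exact Finset.sum_congr rfl fun t _ => by push_cast; ring
      rw [this, hrow]
      ring
    have e5 : ∑ r, ∑ t, (((if r = t then ∑ s, c r s ^ 2 else 0 : ℝ)) : ℂ) * (u r * conj (u t)) =
        ∑ r, ((∑ s, c r s ^ 2 : ℝ) : ℂ) * (u r * conj (u r)) := by
      refine Finset.sum_congr rfl fun r _ => ?_
      rw [Finset.sum_eq_single r] <;> simp +contextual [eq_comm]
    rw [e1, e2]
    simp_rw [hgram]
    simp_rw [Complex.ofReal_add, Complex.ofReal_sub, add_mul, sub_mul, Finset.sum_add_distrib,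
      Finset.sum_sub_distrib]
    rw [e3, e4, e5]
    ring
  have hsymm : ∑ r, ∑ t, |c r t * k r t| * ‖u t‖ ^ 2 = ∑ r, ∑ t, |c r t * k r t| * ‖u r‖ ^ 2 := by
    rw [Finset.sum_comm]
    refine Finset.sum_congr rfl fun r _ => Finset.sum_congr rfl fun t _ => ?_
    rw [hc r t, hk r t, neg_mul_neg]
  have hnorm := congrArg norm hmain
  rw [Complex.norm_real, Real.norm_of_nonneg (by positivity)] at hnorm
  rw [hnorm]
  calc _ ≤ ∑ r, ∑ t, (|c r t * k r t| * ‖u r‖ ^ 2 + |c r t * k r t| * ‖u t‖ ^ 2) +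
        ∑ r, (∑ s, c r s ^ 2) * ‖u r‖ ^ 2 := by
        refine (norm_add_le _ _).trans (add_le_add ?_ ?_)
        · refine (norm_sum_le _ _).trans (Finset.sum_le_sum fun r _ => ?_)
          refine (norm_sum_le _ _).trans (Finset.sum_le_sum fun t _ => ?_)
          rw [norm_mul, norm_mul, Complex.norm_real, Complex.norm_conj, Real.norm_eq_abs, abs_mul,
            abs_two]
          nlinarith [two_mul_le_add_sq ‖u r‖ ‖u t‖, abs_nonneg (c r t * k r t)]
        · refine (norm_sum_le _ _).trans (Finset.sum_le_sum fun r _ => ?_)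
          rw [norm_mul, norm_mul, Complex.norm_real, Complex.norm_conj, Real.norm_of_nonneg
            (Finset.sum_nonneg fun s _ => sq_nonneg _), ← sq]
    _ = ∑ r, (∑ t, (c r t ^ 2 + 2 * |c r t * k r t|)) * ‖u r‖ ^ 2 := by
        simp_rw [Finset.sum_add_distrib]
        rw [hsymm, ← Finset.sum_add_distrib, ← Finset.sum_add_distrib]
        refine Finset.sum_congr rfl fun r _ => ?_
        rw [← Finset.sum_mul, ← Finset.mul_sum]
        ring
    _ ≤ B * ∑ r, ‖u r‖ ^ 2 := by
        rw [Finset.mul_sum]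
        exact Finset.sum_le_sum fun r _ => by gcongr; exact hB r

theorem sin_pi_mul_ne_zero_of_separated {d δ : ℝ} (hδ : 0 < δ) (h : ∀ k : ℤ, δ ≤ |d - k|) :
    Real.sin (Real.pi * d) ≠ 0 := by
  intro h0
  obtain ⟨n, hn⟩ := Real.sin_eq_zero_iff.1 h0
  have : (n : ℝ) = d := by
    have := Real.pi_ne_zero
    field_simp at hn
    linarith
  have := h n
  rw [← ‹(n : ℝ) = d›, sub_self, abs_zero] at this
  linarith

theorem csc_mul_csc_eq_csc_mul_cot_sub_cot {a b : ℝ} (ha : Real.sin a ≠ 0) (hb : Real.sin b ≠ 0)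
    (hab : Real.sin (a - b) ≠ 0) :
    (Real.sin a)⁻¹ * (Real.sin b)⁻¹ =
      (Real.sin (a - b))⁻¹ * (Real.cos b / Real.sin b - Real.cos a / Real.sin a) := by
  have h : (Real.sin (a - b))⁻¹ * Real.sin (a - b) = 1 := inv_mul_cancel₀ hab
  have e : Real.cos b / Real.sin b - Real.cos a / Real.sin a =
      Real.sin (a - b) * ((Real.sin a)⁻¹ * (Real.sin b)⁻¹) := by
    rw [Real.sin_sub]
    field_simp
  rw [e, ← mul_assoc, h, one_mul]

/-- The eigenvalues of the cosecant matrix of `δ`-separated points are at most `δ⁻¹` in absolute value.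
The diagonal entries are `(sin 0)⁻¹ = 0`. -/
theorem sq_eigenvalue_csc_mul_le {ι : Type*} [Fintype ι] [DecidableEq ι] (x : ι → ℝ) {δ : ℝ}
    (hδ : 0 < δ) (hsep : ∀ i j, i ≠ j → ∀ k : ℤ, δ ≤ |x i - x j - k|) (u : ι → ℂ) (ν : ℝ)
    (hu : ∀ r, ∑ t, (((Real.sin (Real.pi * (x r - x t)))⁻¹ : ℝ) : ℂ) * u t =
      Complex.I * ν * u r) :
    ν ^ 2 * ∑ r, ‖u r‖ ^ 2 ≤ (δ ^ 2)⁻¹ * ∑ r, ‖u r‖ ^ 2 := by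
  have hne : ∀ r t, r ≠ t → Real.sin (Real.pi * (x r - x t)) ≠ 0 := fun r t h =>
    sin_pi_mul_ne_zero_of_separated hδ (hsep r t h)
  have hsin : ∀ r t, Real.sin (Real.pi * (x t - x r)) = -Real.sin (Real.pi * (x r - x t)) := by
    intro r t
    rw [← Real.sin_neg]
    ring_nf
  have hcos : ∀ r t, Real.cos (Real.pi * (x t - x r)) = Real.cos (Real.pi * (x r - x t)) := by
    intro r t
    rw [← Real.cos_neg]
    ring_nf
  refine sq_eigenvalue_mul_le_of_cot_identity (fun r t => (Real.sin (Real.pi * (x r - x t)))⁻¹)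
    (fun r t => Real.cos (Real.pi * (x r - x t)) / Real.sin (Real.pi * (x r - x t)))
    ?_ ?_ ?_ ?_ u ν hu
  · intro r t
    simp only [hsin r t, inv_neg]
  · intro r t
    simp only [hsin r t, hcos r t, div_neg]
  · intro r s t hrs hst hrt
    have h := csc_mul_csc_eq_csc_mul_cot_sub_cot (hne r s hrs) (hne t s hst.symm)
      (by rw [← mul_sub, sub_sub_sub_cancel_right]; exact hne r t hrt)
    rw [← mul_sub, sub_sub_sub_cancel_right] at h
    simp only [hsin r s, hsin t s, inv_neg, neg_mul_neg]
    exact h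
  · intro r
    calc _ ≤ ∑ t, 3 / Real.pi ^ 2 * (|x r - x t - round (x r - x t)| ^ 2)⁻¹ :=
          Finset.sum_le_sum fun t _ => csc_sq_add_two_mul_abs_csc_mul_cot_le (x r - x t)
      _ ≤ 3 / Real.pi ^ 2 * (Real.pi ^ 2 / 3 * (δ ^ 2)⁻¹) := by
          rw [← Finset.mul_sum]
          gcongr
          exact sum_inv_sq_abs_sub_round_le x hδ hsep r
      _ = (δ ^ 2)⁻¹ := by
          have := Real.pi_ne_zero
          field_simp

open scoped ComplexOrder in
/-- The upper half of the Hilbert inequality. The form is purely imaginary, as the kernel is real and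
antisymmetric. -/
theorem im_csc_form_le {ι : Type*} [Fintype ι] [DecidableEq ι] (x : ι → ℝ) {δ : ℝ}
    (hδ : 0 < δ) (hsep : ∀ i j, i ≠ j → ∀ k : ℤ, δ ≤ |x i - x j - k|) (u : ι → ℂ) :
    (∑ r, ∑ t, (((Real.sin (Real.pi * (x r - x t)))⁻¹ : ℝ) : ℂ) * (conj (u r) * u t)).im ≤
      δ⁻¹ * ∑ r, ‖u r‖ ^ 2 := by
  set c : ι → ι → ℝ := fun r t => (Real.sin (Real.pi * (x r - x t)))⁻¹ with hc
  have hanti : ∀ r t, c t r = - c r t := by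
    intro r t
    simp only [hc]
    rw [← inv_neg, ← Real.sin_neg]
    ring_nf
  set H : Matrix ι ι ℂ := Matrix.of fun r t =>
    Complex.I * (c r t : ℂ) + if r = t then ((δ⁻¹ : ℝ) : ℂ) else 0 with hH
  have hmul : ∀ (v : ι → ℂ) r,
      (H.mulVec v) r = Complex.I * ∑ t, (c r t : ℂ) * v t + ((δ⁻¹ : ℝ) : ℂ) * v r := by
    intro v r
    simp only [hH, Matrix.mulVec, dotProduct, Matrix.of_apply, add_mul, Finset.sum_add_distrib,
      ite_mul, zero_mul, Finset.sum_ite_eq, Finset.mem_univ, if_true, Finset.mul_sum, mul_assoc]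
  have hherm : H.IsHermitian := by
    ext r t
    simp only [hH, Matrix.conjTranspose_apply, Matrix.of_apply, hanti r t, star_add, star_mul']
    by_cases h : r = t
    · simp [h]
    · simp [h, Ne.symm h]
  -- An eigenvalue `μ` of `H` corresponds to the eigenvalue `i (δ⁻¹ - μ)` of the cosecant matrix.
  have hpos : H.PosSemidef := by
    rw [hherm.posSemidef_iff_eigenvalues_nonneg]
    intro i
    have hv := hherm.mulVec_eigenvectorBasis i
    set v : ι → ℂ := (hherm.eigenvectorBasis i).ofLp with hvdef
    set μ := hherm.eigenvalues i
    have hnorm : ∑ r, ‖v r‖ ^ 2 = 1 := by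
      have := hherm.eigenvectorBasis.orthonormal.1 i
      rw [EuclideanSpace.norm_eq, Real.sqrt_eq_one] at this
      exact this
    have hb := sq_eigenvalue_csc_mul_le x hδ hsep v (δ⁻¹ - μ) (by
      intro r
      have h1 := congrFun hv r
      rw [hmul] at h1
      simp only [Pi.smul_apply, Complex.real_smul] at h1
      simp only [hc] at h1
      push_cast at h1 ⊢
      linear_combination (-Complex.I) * h1 + (∑ t, (Complex.sin (Real.pi * (x r - x t)))⁻¹ * v t) *
        Complex.I_sq)
    rw [hnorm, mul_one, mul_one, ← inv_pow] at hb
    have := abs_le_of_sq_le_sq' hb (by positivity)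
    simp only [Pi.zero_apply]
    linarith [this.2]
  have h := hpos.re_dotProduct_nonneg u
  have e : star u ⬝ᵥ H.mulVec u = Complex.I * (∑ r, ∑ t, (c r t : ℂ) * (conj (u r) * u t)) +
      ((δ⁻¹ * ∑ r, ‖u r‖ ^ 2 : ℝ) : ℂ) := by
    simp only [dotProduct, hmul, Pi.star_apply, mul_add, Finset.sum_add_distrib]
    push_cast
    simp only [Finset.mul_sum, ← Complex.mul_conj', Complex.star_def]
    congr 1
    · refine Finset.sum_congr rfl fun r _ => Finset.sum_congr rfl fun t _ => ?_
      ring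
    · refine Finset.sum_congr rfl fun r _ => ?_
      ring
  rw [e] at h
  simp only [RCLike.re_to_complex, Complex.add_re, Complex.I_mul_re, Complex.ofReal_re] at h
  linarith

/-- The lower half of the Hilbert inequality: conjugating `u` changes the sign of the form. -/
theorem neg_le_im_csc_form {ι : Type*} [Fintype ι] [DecidableEq ι] (x : ι → ℝ) {δ : ℝ}
    (hδ : 0 < δ) (hsep : ∀ i j, i ≠ j → ∀ k : ℤ, δ ≤ |x i - x j - k|) (u : ι → ℂ) :
    -(δ⁻¹ * ∑ r, ‖u r‖ ^ 2) ≤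
    (∑ r, ∑ t, (((Real.sin (Real.pi * (x r - x t)))⁻¹ : ℝ) : ℂ) * (conj (u r) * u t)).im := by
  have h := im_csc_form_le x hδ hsep fun r => conj (u r)
  simp only [Complex.norm_conj, Complex.conj_conj] at h
  rw [neg_le]
  refine le_trans (le_of_eq ?_) h
  rw [← Complex.neg_im, Finset.sum_comm, ← Finset.sum_neg_distrib]
  congr 1
  refine Finset.sum_congr rfl fun r _ => ?_
  rw [← Finset.sum_neg_distrib]
  refine Finset.sum_congr rfl fun t _ => ?_
  have : Real.sin (Real.pi * (x r - x t)) = -Real.sin (Real.pi * (x t - x r)) := by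
    rw [← Real.sin_neg]
    ring_nf
  rw [this, inv_neg]
  push_cast
  ring

/-! ### Exponential sums at separated points -/

/-- `expTwoPi t = exp (2 π i t)`, the standard character of `ℝ / ℤ` as a complex-valued
function of a real variable. -/
noncomputable def expTwoPi (t : ℝ) : ℂ := Complex.exp (2 * Real.pi * Complex.I * t)

theorem expTwoPi_add (s t : ℝ) : expTwoPi (s + t) = expTwoPi s * expTwoPi t := by
  rw [expTwoPi, expTwoPi, expTwoPi, ← Complex.exp_add]
  push_cast
  ring_nf

theorem expTwoPi_nat_mul (n : ℕ) (t : ℝ) : expTwoPi (n * t) = expTwoPi t ^ n := by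
  rw [expTwoPi, expTwoPi, ← Complex.exp_nat_mul]
  push_cast
  ring_nf

theorem conj_expTwoPi (t : ℝ) : conj (expTwoPi t) = expTwoPi (-t) := by
  rw [expTwoPi, expTwoPi, ← Complex.exp_conj]
  simp [Complex.conj_ofNat]

theorem norm_expTwoPi (t : ℝ) : ‖expTwoPi t‖ = 1 := by
  rw [expTwoPi, show 2 * (Real.pi : ℂ) * Complex.I * t = ((2 * Real.pi * t : ℝ) : ℂ) * Complex.I by
    push_cast; ring, Complex.norm_exp_ofReal_mul_I]

theorem expTwoPi_zero : expTwoPi 0 = 1 := by simp [expTwoPi]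

theorem expTwoPi_natCast (n : ℕ) : expTwoPi n = 1 := by
  rw [expTwoPi, ← Complex.exp_nat_mul_two_pi_mul_I n]
  push_cast
  ring_nf

theorem expTwoPi_eq_one_iff {t : ℝ} : expTwoPi t = 1 ↔ ∃ n : ℤ, t = n := by
  rw [expTwoPi, Complex.exp_eq_one_iff]
  refine exists_congr fun n => ?_
  have h : (2 * Real.pi * Complex.I : ℂ) ≠ 0 := Complex.two_pi_I_ne_zero
  rw [mul_comm (n : ℂ), mul_right_inj' h]
  exact_mod_cast Iff.rfl

theorem two_I_mul_sin_pi_mul (t : ℝ) :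
    2 * Complex.I * (Real.sin (Real.pi * t) : ℂ) = expTwoPi (t / 2) - expTwoPi (-(t / 2)) := by
  rw [Complex.ofReal_sin, Complex.sin, expTwoPi, expTwoPi]
  push_cast
  rw [show (2 * Real.pi * Complex.I * (t / 2) : ℂ) = Real.pi * t * Complex.I by ring,
    show (2 * Real.pi * Complex.I * -(t / 2) : ℂ) = -(Real.pi * t) * Complex.I by ring]
  linear_combination (Complex.exp (-(Real.pi * t) * Complex.I) -
    Complex.exp (Real.pi * t * Complex.I)) * Complex.I_sq

/-- The Dirichlet kernel, written so that each exponential factors over `t = x - x'`. -/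
theorem sum_range_expTwoPi_eq (n : ℕ) {t : ℝ} (ht : Real.sin (Real.pi * t) ≠ 0) :
    ∑ k ∈ Finset.range n, expTwoPi (k * t) =
      -(Complex.I / 2) * (((Real.sin (Real.pi * t))⁻¹ : ℝ) : ℂ) *
        (expTwoPi ((n - 1 / 2) * t) - expTwoPi (-(t / 2))) := by
  have hs : (Real.sin (Real.pi * t) : ℂ) ≠ 0 := Complex.ofReal_ne_zero.2 ht
  simp_rw [expTwoPi_nat_mul]
  have hg := geom_sum_mul (expTwoPi t) n
  have h1 : expTwoPi t = expTwoPi (t / 2) * expTwoPi (t / 2) := by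
    rw [← expTwoPi_add]; ring_nf
  have h2 : expTwoPi (t / 2) * expTwoPi (-(t / 2)) = 1 := by
    rw [← expTwoPi_add]; simp [expTwoPi_zero]
  have h3 : expTwoPi ((n - 1 / 2) * t) = expTwoPi t ^ n * expTwoPi (-(t / 2)) := by
    rw [← expTwoPi_nat_mul, ← expTwoPi_add]; ring_nf
  have h4 := two_I_mul_sin_pi_mul t
  have h5 : (∑ k ∈ Finset.range n, expTwoPi t ^ k) *
      (2 * Complex.I * (Real.sin (Real.pi * t) : ℂ)) =
      expTwoPi ((n - 1 / 2) * t) - expTwoPi (-(t / 2)) := by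
    rw [h4, h3]
    generalize expTwoPi t ^ n = E at *
    generalize (∑ k ∈ Finset.range n, expTwoPi t ^ k) = S at *
    rw [h1] at hg
    linear_combination expTwoPi (-(t / 2)) * hg - S * expTwoPi (t / 2) * h2
  rw [← h5]
  push_cast at hs ⊢
  field_simp
  linear_combination (∑ k ∈ Finset.range n, expTwoPi t ^ k) * Complex.I_sq

/-- The lower bound `n - 1 / δ` for exponential sums at `δ`-separated points. -/
theorem sub_inv_mul_sum_le_sum_norm_exp_sum {ι : Type*} [Fintype ι] [DecidableEq ι] (x : ι → ℝ)
    {δ : ℝ} (hδ : 0 < δ) (hsep : ∀ i j, i ≠ j → ∀ k : ℤ, δ ≤ |x i - x j - k|) (n : ℕ)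
    (a : ι → ℂ) :
    (n - δ⁻¹) * ∑ j, ‖a j‖ ^ 2 ≤
      ∑ k ∈ Finset.range n, ‖∑ j, a j * expTwoPi (k * x j)‖ ^ 2 := by
  set c : ι → ι → ℝ := fun r t => (Real.sin (Real.pi * (x r - x t)))⁻¹ with hc
  set b : ι → ℂ := fun t => a t * expTwoPi ((n - 1 / 2) * x t) with hb
  set d : ι → ℂ := fun t => a t * expTwoPi (-(x t / 2)) with hd
  -- The two exponentials of the Dirichlet kernel are absorbed into the coefficients `b` and `d`, which
  -- have the same absolute values as `a`.
  have hker : ∀ r t, conj (a r) * a t * ∑ k ∈ Finset.range n, expTwoPi (k * (x t - x r)) =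
      (if r = t then ((n * ‖a r‖ ^ 2 : ℝ) : ℂ) else 0) +
        Complex.I / 2 * (c r t * (conj (b r) * b t)) -
        Complex.I / 2 * (c r t * (conj (d r) * d t)) := by
    intro r t
    by_cases h : r = t
    · subst h
      simp only [hc, sub_self, mul_zero, Real.sin_zero, inv_zero, Complex.ofReal_zero, zero_mul,
        add_zero, sub_zero, if_true, expTwoPi_zero, Finset.sum_const, Finset.card_range,
        nsmul_eq_mul, mul_one]
      push_cast
      rw [← Complex.mul_conj']
      ring
    · have hs := sin_pi_mul_ne_zero_of_separated hδ (hsep t r (Ne.symm h))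
      rw [sum_range_expTwoPi_eq n hs]
      have h1 : (Real.sin (Real.pi * (x t - x r)))⁻¹ = - c r t := by
        simp only [hc]
        rw [← inv_neg, ← Real.sin_neg]
        ring_nf
      have h2 : expTwoPi ((n - 1 / 2) * (x t - x r)) =
          expTwoPi (-((n - 1 / 2) * x r)) * expTwoPi ((n - 1 / 2) * x t) := by
        rw [← expTwoPi_add]; ring_nf
      have h3 : expTwoPi (-((x t - x r) / 2)) =
          expTwoPi (- -(x r / 2)) * expTwoPi (-(x t / 2)) := by
        rw [← expTwoPi_add]; ring_nf
      rw [h1, h2, h3]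
      simp only [hb, hd, h, if_false, map_mul, conj_expTwoPi]
      push_cast
      ring
  have hexp : ((∑ k ∈ Finset.range n, ‖∑ j, a j * expTwoPi (k * x j)‖ ^ 2 : ℝ) : ℂ) =
      ∑ r, ∑ t, conj (a r) * a t * ∑ k ∈ Finset.range n, expTwoPi (k * (x t - x r)) := by
    simp_rw [Finset.mul_sum]
    push_cast
    rw [eq_comm]
    calc _ = ∑ r, ∑ k ∈ Finset.range n, ∑ t,
          conj (a r) * a t * expTwoPi (k * (x t - x r)) :=
          Finset.sum_congr rfl fun r _ => Finset.sum_comm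
      _ = ∑ k ∈ Finset.range n, ∑ r, ∑ t, conj (a r) * a t * expTwoPi (k * (x t - x r)) :=
          Finset.sum_comm
      _ = _ := by
          refine Finset.sum_congr rfl fun k _ => ?_
          rw [← Complex.conj_mul', map_sum, Finset.sum_mul_sum]
          refine Finset.sum_congr rfl fun r _ => Finset.sum_congr rfl fun t _ => ?_
          rw [map_mul, conj_expTwoPi, show (k : ℝ) * (x t - x r) = -(k * x r) + k * x t by ring,
            expTwoPi_add]
          ring
  have hre := congrArg Complex.re hexp
  simp_rw [hker, Finset.sum_sub_distrib, Finset.sum_add_distrib, ← Finset.mul_sum,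
    Finset.sum_ite_eq, Finset.mem_univ, if_true] at hre
  rw [Complex.ofReal_re, ← Complex.ofReal_sum, Complex.sub_re, Complex.add_re,
    Complex.ofReal_re] at hre
  have hI : ∀ z : ℂ, (Complex.I / 2 * z).re = -(z.im / 2) := by
    intro z
    rw [div_mul_eq_mul_div, Complex.div_ofNat_re, Complex.I_mul_re, neg_div]
  rw [hI, hI] at hre
  have hbn := im_csc_form_le x hδ hsep b
  have hdn := neg_le_im_csc_form x hδ hsep d
  simp only [hb, hd, norm_mul, norm_expTwoPi, mul_one] at hbn hdn
  rw [hre, sub_mul, ← Finset.mul_sum]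
  simp only [hb, hd, hc]
  linarith

/-! ### Replicating the points -/

theorem sum_range_expTwoPi_div_eq_zero {K k : ℕ} (hK : 0 < K) (h : ¬ K ∣ k) :
    ∑ l ∈ Finset.range K, expTwoPi (k * (l / K)) = 0 := by
  have hK' : (K : ℝ) ≠ 0 := by positivity
  have h1 : ∀ l : ℕ, expTwoPi (k * (l / K)) = expTwoPi (k / K) ^ l := by
    intro l
    rw [← expTwoPi_nat_mul]
    ring_nf
  simp_rw [h1]
  have hne : expTwoPi (k / K) - 1 ≠ 0 := by
    rw [sub_ne_zero, Ne, expTwoPi_eq_one_iff]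
    rintro ⟨n, hn⟩
    rw [div_eq_iff hK'] at hn
    have : (k : ℤ) = n * K := by exact_mod_cast hn
    exact h (Int.natCast_dvd_natCast.1 ⟨n, by rw [this, mul_comm]⟩)
  refine (mul_eq_zero.1 ?_).resolve_right hne
  rw [geom_sum_mul, ← expTwoPi_nat_mul, mul_div_cancel₀ _ hK', expTwoPi_natCast, sub_self]

/-- Every `y j` is replaced by the `K` solutions `z` of `K * z ≡ y j` modulo `1`; the separation is
divided by `K`. -/
theorem separated_add_div {ι : Type*} {y : ι → ℝ} {q : ℝ} (hq1 : q ≤ 1)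
    (hsep : ∀ i j, i ≠ j → ∀ k : ℤ, q ≤ |y i - y j - k|) {K : ℕ} (hK : 0 < K)
    (p p' : ι × Fin K) (hp : p ≠ p') (m : ℤ) :
    q / K ≤ |(y p.1 + (p.2 : ℕ)) / K - (y p'.1 + (p'.2 : ℕ)) / K - m| := by
  have hK' : (0 : ℝ) < K := by exact_mod_cast hK
  have e : (y p.1 + (p.2 : ℕ)) / K - (y p'.1 + (p'.2 : ℕ)) / K - m =
      (y p.1 - y p'.1 - ((m * K + (p'.2 : ℕ) - (p.2 : ℕ) : ℤ) : ℝ)) / K := by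
    push_cast
    field_simp
    ring
  rw [e, abs_div, abs_of_pos hK']
  refine div_le_div_of_nonneg_right ?_ hK'.le
  by_cases h : p.1 = p'.1
  · -- equal base points: the difference is a nonzero integer
    have h2 : (p.2 : ℕ) ≠ p'.2 := fun h2 => hp (Prod.ext h (Fin.ext h2))
    rw [h, sub_self, zero_sub, abs_neg]
    refine hq1.trans ?_
    have hz : m * K + (p'.2 : ℕ) - (p.2 : ℕ) ≠ (0 : ℤ) := by
      intro hz
      have h3 := p.2.isLt
      have h4 := p'.2.isLt
      have h5 : (K : ℤ) ∣ ((p.2 : ℕ) : ℤ) - (p'.2 : ℕ) := ⟨m, by linarith⟩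
      have h6 := Int.eq_zero_of_abs_lt_dvd h5 (by rw [abs_lt]; omega)
      omega
    exact_mod_cast Int.one_le_abs hz
  · exact hsep _ _ h _

/-- The bound `n - 1 / δ` for the replicated points, `δ = q / K` and `n = N * K + K - 1`.
The frequencies are numbered `m + 1` with `m < n`; among `1, …, n` exactly the `N` numbers
`K, 2 * K, …, N * K` are multiples of `K`, and `n` is the largest length with this property. -/
theorem sub_inv_mul_sum_le_of_replication {ι : Type*} [Fintype ι] [DecidableEq ι] {y : ι → ℝ}
    {q : ℝ} (hq : 0 < q) (hq1 : q ≤ 1)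
    (hsep : ∀ i j, i ≠ j → ∀ k : ℤ, q ≤ |y i - y j - k|) (N : ℕ) (a : ι → ℂ) {K : ℕ}
    (hK : 0 < K) :
    (N + 1 - (K : ℝ)⁻¹ - q⁻¹) * ∑ j, ‖a j‖ ^ 2 ≤
      ∑ k ∈ Finset.range N, ‖∑ j, a j * expTwoPi (k * y j)‖ ^ 2 := by
  have hK' : (0 : ℝ) < K := by exact_mod_cast hK
  set n := N * K + (K - 1) with hn
  have hnr : (n : ℝ) = N * K + K - 1 := by
    rw [hn]
    push_cast [Nat.cast_sub (Nat.succ_le_of_lt hK)]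
    ring
  -- The coefficients shift the frequency `m` to `m + 1`, and the frequency `(i + 1) * K` back to `i`.
  have h := sub_inv_mul_sum_le_sum_norm_exp_sum
    (fun p : ι × Fin K => (y p.1 + (p.2 : ℕ)) / K) (div_pos hq hK')
    (separated_add_div hq1 hsep hK) n
    (fun p => a p.1 * expTwoPi ((y p.1 + (p.2 : ℕ)) / K - y p.1))
  have hinner : ∀ m : ℕ, ∑ p : ι × Fin K, a p.1 * expTwoPi ((y p.1 + (p.2 : ℕ)) / K - y p.1) *
      expTwoPi (m * ((y p.1 + (p.2 : ℕ)) / K)) =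
      (∑ j, a j * expTwoPi ((m + 1 : ℕ) * (y j / K) - y j)) *
        ∑ l ∈ Finset.range K, expTwoPi ((m + 1 : ℕ) * (l / K)) := by
    intro m
    rw [Fintype.sum_prod_type, Finset.sum_mul]
    refine Finset.sum_congr rfl fun j _ => ?_
    rw [Finset.mul_sum, ← Fin.sum_univ_eq_sum_range
      (fun l => a j * expTwoPi ((m + 1 : ℕ) * (y j / K) - y j) *
        expTwoPi ((m + 1 : ℕ) * ((l : ℕ) / K)))]
    refine Finset.sum_congr rfl fun l _ => ?_
    rw [mul_assoc, mul_assoc, ← expTwoPi_add, ← expTwoPi_add]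
    congr 2
    push_cast
    ring
  simp_rw [hinner] at h
  have hsum : ∑ m ∈ Finset.range n, ‖(∑ j, a j * expTwoPi ((m + 1 : ℕ) * (y j / K) - y j)) *
        ∑ l ∈ Finset.range K, expTwoPi ((m + 1 : ℕ) * (l / K))‖ ^ 2 =
      K ^ 2 * ∑ i ∈ Finset.range N, ‖∑ j, a j * expTwoPi (i * y j)‖ ^ 2 := by
    rw [Finset.mul_sum, eq_comm]
    have hsucc : ∀ i : ℕ, i * K + (K - 1) + 1 = (i + 1) * K := by
      intro i
      rw [add_assoc, Nat.sub_add_cancel hK]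
      ring
    refine Finset.sum_of_injOn (fun i => i * K + (K - 1)) ?_ ?_ ?_ ?_
    · intro i _ j _ hij
      exact Nat.eq_of_mul_eq_mul_right hK (Nat.add_right_cancel hij)
    · intro i hi
      simp only [Finset.coe_range, Set.mem_Iio] at hi ⊢
      have := Nat.mul_lt_mul_of_pos_right hi hK
      omega
    · intro m hm hmi
      have hdvd : ¬ K ∣ m + 1 := by
        rintro ⟨i, hi⟩
        obtain ⟨i, rfl⟩ : ∃ i', i = i' + 1 := Nat.exists_eq_succ_of_ne_zero (by
          rintro rfl
          simp at hi)
        have hmi' : i * K + (K - 1) = m := by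
          have := hsucc i
          rw [mul_comm] at hi
          omega
        refine hmi ⟨i, ?_, hmi'⟩
        simp only [Finset.coe_range, Set.mem_Iio, Finset.mem_range] at hm ⊢
        by_contra hle
        have := Nat.mul_le_mul_right K (not_lt.1 hle)
        omega
      rw [sum_range_expTwoPi_div_eq_zero hK hdvd, mul_zero, norm_zero]
      norm_num
    · intro i _
      simp only [hsucc]
      have h1 : ∀ l : ℕ, expTwoPi (((i + 1) * K : ℕ) * (l / K)) = 1 := by
        intro l
        rw [← expTwoPi_natCast ((i + 1) * l)]
        congr 1
        push_cast
        field_simp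
      have h2 : ∀ j, expTwoPi (((i + 1) * K : ℕ) * (y j / K) - y j) = expTwoPi (i * y j) := by
        intro j
        congr 1
        push_cast
        field_simp
        ring
      simp_rw [h1, h2]
      rw [Finset.sum_const, Finset.card_range, nsmul_eq_mul, mul_one, norm_mul, mul_pow,
        Complex.norm_natCast]
      ring
  rw [hsum, Fintype.sum_prod_type] at h
  simp only [norm_mul, norm_expTwoPi, mul_one, Finset.sum_const, Finset.card_univ,
    Fintype.card_fin, nsmul_eq_mul] at h
  rw [← Finset.mul_sum, hnr] at h
  refine le_of_mul_le_mul_left (le_trans (le_of_eq ?_) h) (by positivity : (0 : ℝ) < K ^ 2)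
  field_simp

theorem add_one_sub_inv_mul_sum_le_sum_norm_exp_sum {ι : Type*} [Fintype ι] [DecidableEq ι]
    {y : ι → ℝ} {q : ℝ} (hq : 0 < q) (hq1 : q ≤ 1)
    (hsep : ∀ i j, i ≠ j → ∀ k : ℤ, q ≤ |y i - y j - k|) (N : ℕ) (a : ι → ℂ) :
    (N + 1 - q⁻¹) * ∑ j, ‖a j‖ ^ 2 ≤
      ∑ k ∈ Finset.range N, ‖∑ j, a j * expTwoPi (k * y j)‖ ^ 2 := by
  have hlim : Filter.Tendsto (fun K : ℕ => (N + 1 - (K : ℝ)⁻¹ - q⁻¹) * ∑ j, ‖a j‖ ^ 2)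
      Filter.atTop (nhds ((N + 1 - 0 - q⁻¹) * ∑ j, ‖a j‖ ^ 2)) :=
    ((tendsto_const_nhds.sub tendsto_inv_atTop_nhds_zero_nat).sub_const _).mul_const _
  rw [sub_zero] at hlim
  exact le_of_tendsto hlim ((Filter.eventually_gt_atTop 0).mono fun K hK =>
    sub_inv_mul_sum_le_of_replication hq hq1 hsep N a hK)

/-! ### The smallest singular value -/

theorem LinearMap.le_sq_singularValues {𝕜 E F : Type*} [RCLike 𝕜] [NormedAddCommGroup E]
    [InnerProductSpace 𝕜 E] [FiniteDimensional 𝕜 E] [NormedAddCommGroup F] [InnerProductSpace 𝕜 F]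
    [FiniteDimensional 𝕜 F] (T : E →ₗ[𝕜] F) {c : ℝ} (hT : ∀ v, c * ‖v‖ ^ 2 ≤ ‖T v‖ ^ 2) {n : ℕ}
    (hn : n < Module.finrank 𝕜 E) : c ≤ T.singularValues n ^ 2 := by
  obtain ⟨v, hv⟩ := (T.hasEigenvalue_adjoint_comp_self_sq_singularValues hn).exists_hasEigenvector
  have hv0 : 0 < ‖v‖ ^ 2 := by
    have := norm_pos_iff.2 hv.2
    positivity
  refine le_of_mul_le_mul_right ((hT v).trans (le_of_eq ?_)) hv0
  have h1 : inner 𝕜 v (T.adjoint (T v)) = inner 𝕜 (T v) (T v) := T.adjoint_inner_right v (T v)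
  have h2 : T.adjoint (T v) = (((T.singularValues n ^ 2 : ℝ)) : 𝕜) • v := by
    have := hv.apply_eq_smul
    simpa using this
  rw [h2, inner_smul_right, inner_self_eq_norm_sq_to_K, inner_self_eq_norm_sq_to_K] at h1
  exact_mod_cast h1.symm

theorem mainTheorem5 (N M : ℕ) (hM : 1 ≤ M) (q : ℝ) (hq : 0 < q) (hq1 : q ≤ 1)
    (y : Fin M → ℝ) (hy : ∀ j, y j ∈ Set.Ico (0 : ℝ) 1) (hsep : QSeparated q y) :
    (N : ℝ) + 1 - 1 / q ≤ smallestSingularValue (expVandermonde N y) ^ 2 := by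
  rw [one_div]
  refine LinearMap.le_sq_singularValues _ (fun v => ?_) (by
    rw [finrank_euclideanSpace_fin]
    omega)
  have h := add_one_sub_inv_mul_sum_le_sum_norm_exp_sum hq hq1
    (fun i j hij k => (hsep i j hij).trans ((wrapDist_isLeast _ _).2 ⟨k, rfl⟩)) N v.ofLp
  rw [EuclideanSpace.norm_sq_eq, EuclideanSpace.norm_sq_eq]
  refine h.trans (le_of_eq ?_)
  rw [← Fin.sum_univ_eq_sum_range (fun k => ‖∑ j, v.ofLp j * expTwoPi (k * y j)‖ ^ 2)]
  refine Finset.sum_congr rfl fun k _ => ?_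
  rw [Matrix.ofLp_toLpLin, Matrix.toLin'_apply, Matrix.mulVec, dotProduct]
  congr 2
  refine Finset.sum_congr rfl fun j _ => ?_
  rw [expVandermonde, Matrix.of_apply, expTwoPi, mul_comm]
  push_cast
  ring_nf
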